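/- Let $\Theta\subseteq\mathbb{R}$ be open and let $t\mapsto\rho_t$ be a family of qubit density operators (positive semidefinite $2\times2$ complex matrices of trace one) that is continuously differentiable on $\Theta$. Write $\rho_t=\frac12\left(I+\omega_t\cdot\hat\sigma\right)$ with Bloch vector $\omega_t\in\mathbb{R}^3$, where $\hat\sigma=(\hat\sigma_x,\hat\sigma_y,\hat\sigma_z)$ are the Pauli matrices. Fix $\lambda\in\Theta$, let $\partial_\lambda\omega_\lambda$ be the derivative of $t\mapsto\omega_t$ at $\lambda$, and assume $\langle\partial_\lambda\omega_\lambda,\omega_\lambda\rangle\neq0$. Put $$C_1=\frac{1}{\|\partial_\lambda\omega_\lambda\|_2^2}\left(4+\frac14\,\frac{\|\partial_\lambda\omega_\lambda\|_2^2}{|\langle\partial_\lambda\omega_\lambda,\omega_\lambda\rangle|^2}\right)^{-1},\qquad C_2=\frac{1}{\|\partial_\lambda\omega_\lambda\|_2^2}.$$ A qubit channel $\mathcal{E}$ (a completely positive trace-preserving linear map on $2\times2$ complex matrices) belongs to $\mathrm{LDP}_\varepsilon$ if $\mathrm{Tr}(M\mathcal{E}(\rho))\le e^{\varepsilon}\,\mathrm{Tr}(M\mathcal{E}(\sigma))$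 for all $0\preceq M\preceq I$ and all density operators $\rho,\sigma$. For $\alpha>0$, let $N_\alpha(\mathcal{E})\in\{1,2,\dots\}\cup\{\infty\}$ be the least number $N\ge1$ of copies for which there is an estimator $\hat\lambda$ (a POVM on $(\mathbb{C}^2)^{\otimes N}$ followed by a measurable real function of its outcome), applied to $\mathcal{E}(\rho_t)^{\otimes N}$, that is unbiased at $\lambda$ and satisfies $\mathbb{E}_\lambda\{(\lambda-\hat\lambda)^2\}\le\alpha$; it is $\infty$ if there is no such $N$. Here unbiased at $\lambda$ is meant in the local sense: $\mathbb{E}_t\{\hat\lambda\}$ exists for all $t$ near $\lambda$, $\mathbb{E}_\lambda\{\hat\lambda\}=\lambda$, and $\frac{d}{dt}\mathbb{E}_t\{\hat\lambda\}\big|_{t=\lambda}=1$. Then for every $\alpha>0$ and every $\varepsilon\in(0,1)$, $$\frac{C_1}{9\,\alpha\,\varepsilon^2}\ \le\ \inf_{\mathcal{E}\in\mathrm{LDP}_\varepsilon}N_\alpha(\mathcal{E})\ \le\ \max\left\{1,\ \frac{C_2\,(e+1)^2}{\alpha\,\varepsilon^2}\right\}.$$ In particular, whenever $\alpha\varepsilon^2\le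 C_2(e+1)^2$, the infimum is at most $C_2(e+1)^2/(\alpha\varepsilon^2)$. -/

import Mathlib

open MeasureTheory Filter Topology
open scoped Matrix ComplexOrder MatrixOrder Matrix.Norms.L2Operator CStarAlgebra ENNReal

noncomputable section

namespace QuantumLDP

/-- Density operators on `ℂⁿ` (in the computational basis): positive semidefinite, unit trace. -/
structure DensityOperator (n : Type) [Fintype n] where
  /-- the underlying matrix -/
  toMatrix : Matrix n n ℂ
  posSemidef : toMatrix.PosSemidef
  trace_eq_one : toMatrix.trace = 1

/-- Qubit states. -/
abbrev Qubit : Type := DensityOperator (Fin 2)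

/-- The Pauli matrices `σ_x`, `σ_y`, `σ_z`. -/
def pauli : Fin 3 → Matrix (Fin 2) (Fin 2) ℂ :=
  ![!![0, 1; 1, 0], !![0, -Complex.I; Complex.I, 0], !![1, 0; 0, -1]]

/-- The Bloch vector of a qubit state `ρ`: the coordinates are `ω_i = Tr(σ_i ρ)`. -/
def blochVector (ρ : Qubit) : EuclideanSpace ℝ (Fin 3) :=
  WithLp.toLp 2 fun i => (pauli i * ρ.toMatrix).trace.re

/-- The Bloch representation `ρ = (I + ω_x σ_x + ω_y σ_y + ω_z σ_z) / 2`. -/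
theorem toMatrix_eq_bloch (ρ : Qubit) :
    ρ.toMatrix = (1 / 2 : ℂ) • (1 + ∑ i, (blochVector ρ i : ℂ) • pauli i) := by
  have hH := ρ.posSemidef.isHermitian
  have ht := ρ.trace_eq_one
  have h00 := hH.apply 0 0
  have h01 := hH.apply 0 1
  have h11 := hH.apply 1 1
  simp only [Matrix.trace_fin_two] at ht
  simp only [Complex.ext_iff, Complex.star_def, Complex.conj_re, Complex.conj_im,
    Complex.add_re, Complex.add_im, Complex.one_re, Complex.one_im] at ht h00 h01 h11
  ext i j
  fin_cases i <;> fin_cases j <;> apply Complex.ext <;>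
    simp [blochVector, pauli, Fin.sum_univ_three, Matrix.trace_fin_two, Matrix.mul_apply,
      Fin.sum_univ_two] <;> linarith

/-- A qubit quantum channel: a completely positive and trace-preserving linear map. -/
structure QubitChannel where
  /-- the underlying completely positive map -/
  toCP : Matrix (Fin 2) (Fin 2) ℂ →CP Matrix (Fin 2) (Fin 2) ℂ
  trace_preserving : ∀ X : Matrix (Fin 2) (Fin 2) ℂ, (toCP X).trace = X.trace

/-- The output state `𝓔(ρ)` of a channel. -/
def QubitChannel.apply (E : QubitChannel) (ρ : Qubit) : Qubit where
  toMatrix := E.toCP ρ.toMatrix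
  posSemidef := by
    have h : (0 : Matrix (Fin 2) (Fin 2) ℂ) ≤ E.toCP ρ.toMatrix :=
      map_nonneg E.toCP (Matrix.nonneg_iff_posSemidef.mpr ρ.posSemidef)
    exact Matrix.nonneg_iff_posSemidef.mp h
  trace_eq_one := by rw [E.trace_preserving, ρ.trace_eq_one]

/-- The set of `ε`-locally differentially private qubit channels:
`Tr(M 𝓔(ρ)) ≤ e^ε Tr(M 𝓔(σ))` for all `0 ≼ M ≼ I` and all states `ρ`, `σ`.
(These traces are real numbers.) -/
def LDP (ε : ℝ) : Set QubitChannel :=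
  {E | ∀ M : Matrix (Fin 2) (Fin 2) ℂ, M.PosSemidef → (1 - M).PosSemidef →
    ∀ ρ σ : Qubit, (M * (E.apply ρ).toMatrix).trace.re
      ≤ Real.exp ε * (M * (E.apply σ).toMatrix).trace.re}

/-- The matrix of `X ⊗ ⋯ ⊗ X` (`N` factors) in the product basis, indexed by `Fin N → n`. -/
def tensorPowMatrix {n : Type} (N : ℕ) (X : Matrix n n ℂ) :
    Matrix (Fin N → n) (Fin N → n) ℂ :=
  Matrix.of fun a b => ∏ k, X (a k) (b k)

theorem tensorPowMatrix_mul {n : Type} [Fintype n] (N : ℕ) (X Y : Matrix n n ℂ) :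
    tensorPowMatrix N (X * Y) = tensorPowMatrix N X * tensorPowMatrix N Y := by
  classical
  ext a b
  simp only [tensorPowMatrix, Matrix.of_apply, Matrix.mul_apply, ← Finset.prod_mul_distrib]
  rw [Finset.prod_univ_sum, Fintype.piFinset_univ]

theorem tensorPowMatrix_conjTranspose {n : Type} (N : ℕ) (X : Matrix n n ℂ) :
    tensorPowMatrix N Xᴴ = (tensorPowMatrix N X)ᴴ := by
  ext a b
  simp [tensorPowMatrix, Matrix.conjTranspose_apply]

theorem tensorPowMatrix_trace {n : Type} [Fintype n] (N : ℕ) (X : Matrix n n ℂ) :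
    (tensorPowMatrix N X).trace = X.trace ^ N := by
  classical
  simp only [tensorPowMatrix, Matrix.trace, Matrix.diag_apply, Matrix.of_apply]
  have h := Finset.prod_univ_sum (fun _ : Fin N => (Finset.univ : Finset n)) (fun _ i => X i i)
  rw [Fintype.piFinset_univ] at h
  rw [← h, Finset.prod_const, Finset.card_univ, Fintype.card_fin]

/-- The state `ρ^{⊗N}` of `N` independent copies. -/
def DensityOperator.tensorPow {n : Type} [Fintype n] (N : ℕ) (ρ : DensityOperator n) :
    DensityOperator (Fin N → n) where
  toMatrix := tensorPowMatrix N ρ.toMatrix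
  posSemidef := by
    classical
    obtain ⟨B, hB⟩ := CStarAlgebra.nonneg_iff_eq_star_mul_self.mp
      (Matrix.nonneg_iff_posSemidef.mpr ρ.posSemidef)
    rw [hB, tensorPowMatrix_mul, Matrix.star_eq_conjTranspose, tensorPowMatrix_conjTranspose]
    exact Matrix.posSemidef_conjTranspose_mul_self _
  trace_eq_one := by rw [tensorPowMatrix_trace, ρ.trace_eq_one, one_pow]

/-- A positive operator-valued measure on `ℂⁿ` with outcomes in the measurable space `Ω`:
a `σ`-additive set function with positive semidefinite values and total mass `I`. -/
structure POVM (Ω : Type) [MeasurableSpace Ω] (n : Type) [Fintype n] [DecidableEq n] where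
  /-- the underlying matrix-valued measure -/
  effect : VectorMeasure Ω (Matrix n n ℂ)
  posSemidef : ∀ A : Set Ω, MeasurableSet A → (effect A).PosSemidef
  effect_univ : effect Set.univ = 1

theorem trace_mul_nonneg {n : Type} [Fintype n] {X Y : Matrix n n ℂ}
    (hX : X.PosSemidef) (hY : Y.PosSemidef) : 0 ≤ (X * Y).trace.re := by
  classical
  obtain ⟨B, hB⟩ := CStarAlgebra.nonneg_iff_eq_star_mul_self.mp
    (Matrix.nonneg_iff_posSemidef.mpr hX)
  rw [hB, Matrix.star_eq_conjTranspose, Matrix.mul_assoc, Matrix.trace_mul_comm]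
  exact (Complex.le_def.mp (hY.mul_mul_conjTranspose_same B).trace_nonneg).1

/-- Born's rule: measuring `M` in the state `ρ`, the outcome lies in a measurable set `A` with
probability `Tr(M(A) ρ)`. -/
def POVM.outcomeLaw {Ω : Type} [MeasurableSpace Ω] {n : Type} [Fintype n] [DecidableEq n]
    (M : POVM Ω n) (ρ : DensityOperator n) : Measure Ω :=
  Measure.ofMeasurable (fun A _ => ENNReal.ofReal (M.effect A * ρ.toMatrix).trace.re)
    (by simp)
    (by
      intro f hf hd
      have hs : HasSum (fun i => (M.effect (f i) * ρ.toMatrix).trace.re)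
          (M.effect (⋃ i, f i) * ρ.toMatrix).trace.re := by
        have h := M.effect.hasSum_of_disjoint_iUnion hf hd
        have hc : Continuous fun X : Matrix n n ℂ => (X * ρ.toMatrix).trace.re := by
          fun_prop
        let g : Matrix n n ℂ →+ ℝ :=
          { toFun := fun X => (X * ρ.toMatrix).trace.re
            map_zero' := by simp
            map_add' := by intro X Y; simp [Matrix.add_mul] }
        exact h.map g hc
      rw [← hs.tsum_eq]
      exact ENNReal.ofReal_tsum_of_nonneg
        (fun i => trace_mul_nonneg (M.posSemidef _ (hf i)) ρ.posSemidef) hs.summable)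

theorem POVM.outcomeLaw_apply {Ω : Type} [MeasurableSpace Ω] {n : Type} [Fintype n]
    [DecidableEq n] (M : POVM Ω n) (ρ : DensityOperator n) {A : Set Ω} (hA : MeasurableSet A) :
    M.outcomeLaw ρ A = ENNReal.ofReal (M.effect A * ρ.toMatrix).trace.re :=
  Measure.ofMeasurable_apply A hA

/-- An estimator of a real parameter from a quantum system `ℂⁿ`: a POVM, followed by a measurable
real-valued function of the measurement outcome. -/
structure Estimator (n : Type) [Fintype n] [DecidableEq n] where
  /-- the outcome space -/
  Outcome : Type
  [measurableSpace : MeasurableSpace Outcome]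
  /-- the measurement -/
  povm : POVM Outcome n
  /-- the estimate computed from the outcome -/
  est : Outcome → ℝ
  measurable_est : Measurable est

attribute [instance] Estimator.measurableSpace

namespace Estimator

variable {n : Type} [Fintype n] [DecidableEq n]

/-- The expectation of the estimate in the state `ρ` (meaningful if the estimate is integrable). -/
def mean (T : Estimator n) (ρ : DensityOperator n) : ℝ :=
  ∫ x, T.est x ∂(T.povm.outcomeLaw ρ)

/-- The mean squared error about the parameter value `θ` in the state `ρ`, possibly infinite. -/
def mse (T : Estimator n) (ρ : DensityOperator n) (θ : ℝ) : ℝ≥0∞ :=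
  ∫⁻ x, ENNReal.ofReal ((θ - T.est x) ^ 2) ∂(T.povm.outcomeLaw ρ)

/-- The estimator is (locally) unbiased at the parameter value `θ` for the family `ρ`: the
expectation exists for all parameters near `θ`, it equals `θ` at `θ`, and its derivative with
respect to the parameter at `θ` equals `1`. -/
def IsUnbiasedAt (T : Estimator n) (ρ : ℝ → DensityOperator n) (θ : ℝ) : Prop :=
  (∀ᶠ t in 𝓝 θ, Integrable T.est (T.povm.outcomeLaw (ρ t))) ∧
    T.mean (ρ θ) = θ ∧ HasDerivAt (fun t => T.mean (ρ t)) 1 θ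

end Estimator

/-- The sample complexity `N_α(𝓔)` at the parameter value `θ`: the least number `N ≥ 1` of copies
of `𝓔(ρ_θ)` for which some unbiased estimator based on `𝓔(ρ_θ)^{⊗N}` has mean squared error at
most `α`; it is `⊤` if there is no such `N`. -/
def sampleComplexity (ρ : ℝ → Qubit) (θ α : ℝ) (E : QubitChannel) : ℕ∞ :=
  ⨅ (N : ℕ) (_ : 1 ≤ N)
    (_ : ∃ T : Estimator (Fin N → Fin 2),
      T.IsUnbiasedAt (fun t => (E.apply (ρ t)).tensorPow N) θ ∧
        T.mse ((E.apply (ρ θ)).tensorPow N) θ ≤ ENNReal.ofReal α), (N : ℕ∞)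

/-- `⨅ N_α(𝓔)` over all `ε`-locally differentially private channels `𝓔`. -/
def bestSampleComplexity (ρ : ℝ → Qubit) (θ α ε : ℝ) : ℕ∞ :=
  ⨅ E ∈ LDP ε, sampleComplexity ρ θ α E

/-- `C₁`, as a function of the Bloch vector `ω` and its derivative `ω'`. -/
def C₁ (ω ω' : EuclideanSpace ℝ (Fin 3)) : ℝ :=
  1 / ‖ω'‖ ^ 2 * (4 + 1 / 4 * (‖ω'‖ ^ 2 / |inner ℝ ω' ω| ^ 2))⁻¹

/-- `C₂`, as a function of the derivative `ω'` of the Bloch vector. -/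
def C₂ (ω' : EuclideanSpace ℝ (Fin 3)) : ℝ :=
  1 / ‖ω'‖ ^ 2

end QuantumLDP

end

/-! Lower bound: a finite-difference (Chapman–Robbins) argument replaces quantum Fisher information.
Write `S`, `T` for the channel outputs at `θ` and at a nearby `t`, and let `r` be the distance
between the two input Bloch vectors. The input difference is `r / 2` times a difference of antipodal
pure states, so privacy forces `-a S ≤ T - S ≤ a S` with `a = (3/2) ε r`
(`LDP.posSemidef_smul_sub_sub`). Hence `Tr (T S⁻¹ T) ≤ 1 + a²`. This trace is multiplicative under
tensor powers, so Cauchy–Schwarz for an arbitrary POVM on `N` copies gives `(mean_t - θ)² ≤ α ((1 +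
a²)^N - 1)` (`Estimator.sq_mean_sub_le`). Dividing by `(t - θ)²` and letting `t → θ` yields `1 ≤ α
(9/4) ε² ‖ω'‖² N` (`one_le_of_isUnbiasedAt`). Since `C₁ ‖ω'‖² ≤ 1/4`, this is stronger than needed.

Upper bound: measure the noisy spin observable along `u = ω' / ‖ω'‖` and record the result as a
classical bit with bias `(2ε/5) ⟨u, ω⟩` (`exists_LDP_channel`). A rescaled sum of the centred bits
is locally unbiased with variance at most `25 / (4 N ε² ‖ω'‖²)`. The constant `(e + 1)²` leaves room
for rounding `N` up to an integer. -/

namespace QuantumLDP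

/-! ### Matrix form of the Chapman–Robbins inequality for tensor powers -/

section Matrices

variable {n : Type} [Fintype n] [DecidableEq n]

/-- If `-a S ≤ Δ ≤ a S` with `S` positive definite, then `Tr (Δ S⁻¹ Δ) ≤ a² Tr S`. -/
theorem trace_mul_inv_mul_le {S Δ : Matrix n n ℂ} (hS : S.PosDef) {a : ℝ} (ha : 0 < a)
    (h₁ : ((a : ℂ) • S - Δ).PosSemidef) (h₂ : ((a : ℂ) • S + Δ).PosSemidef) :
    (Δ * S⁻¹ * Δ).trace.re ≤ a ^ 2 * S.trace.re := by
  have hdet : IsUnit S.det := (Matrix.isUnit_iff_isUnit_det S).mp hS.isUnit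
  have hSW : S * S⁻¹ = 1 := Matrix.mul_nonsing_inv _ hdet
  have hWS : S⁻¹ * S = 1 := Matrix.nonsing_inv_mul _ hdet
  have hW : (S⁻¹)ᴴ = S⁻¹ := hS.isHermitian.inv
  set W := S⁻¹
  set P := (a : ℂ) • S - Δ with hP
  set Q := (a : ℂ) • S + Δ with hQ
  set X := ((a : ℂ) ^ 2) • S - Δ * W * Δ with hX
  have hSWx : ∀ Y : Matrix n n ℂ, S * (W * Y) = Y := fun Y => by
    rw [← Matrix.mul_assoc, hSW, Matrix.one_mul]
  -- `P W Q` and `Q W P` both equal `X`, so the positive matrices `P W Q W P` and `Q W P W Q` add up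
  -- to `X W (P + Q) = 2a X`; hence `X` has nonnegative trace.
  have hPQ : P * W * Q = X := by
    simp only [hP, hQ, hX, sub_mul, mul_add, Matrix.smul_mul, Matrix.mul_smul, Matrix.mul_assoc,
      hSWx, hWS, Matrix.mul_one]
    module
  have hQP : Q * W * P = X := by
    simp only [hP, hQ, hX, add_mul, mul_sub, Matrix.smul_mul, Matrix.mul_smul, Matrix.mul_assoc,
      hSWx, hWS, Matrix.mul_one]
    module
  have h₃ : ((P * W) * Q * (P * W)ᴴ).PosSemidef := h₂.mul_mul_conjTranspose_same _
  have h₄ : ((Q * W) * P * (Q * W)ᴴ).PosSemidef := h₁.mul_mul_conjTranspose_same _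
  have h₅ : (P * W) * Q * (P * W)ᴴ + (Q * W) * P * (Q * W)ᴴ = ((2 * a : ℝ) : ℂ) • X := by
    rw [hPQ, hQP, Matrix.conjTranspose_mul, Matrix.conjTranspose_mul, hW,
      h₁.isHermitian, h₂.isHermitian, ← mul_add, ← mul_add,
      show P + Q = ((2 * a : ℝ) : ℂ) • S by rw [hP, hQ]; push_cast; module,
      Matrix.mul_smul, Matrix.mul_smul, hWS, Matrix.mul_one]
  have h₆ := (Complex.le_def.mp (h₃.add h₄).trace_nonneg).1
  rw [h₅, Matrix.trace_smul, smul_eq_mul, Complex.re_ofReal_mul, Complex.zero_re] at h₆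
  have h₇ : 0 ≤ X.trace.re := nonneg_of_mul_nonneg_right h₆ (by positivity)
  rw [hX, Matrix.trace_sub, Matrix.trace_smul, smul_eq_mul, ← Complex.ofReal_pow, Complex.sub_re,
    Complex.re_ofReal_mul] at h₇
  linarith

/-- A Cauchy–Schwarz inequality for a finite resolution of the identity, in quadratic form. -/
theorem quadratic_nonneg {ι : Type*} (s : Finset ι) (M : ι → Matrix n n ℂ)
    (hM : ∀ i ∈ s, (M i).PosSemidef) (hsum : ∑ i ∈ s, M i = 1) (g : ι → ℝ)
    {Q : Matrix n n ℂ} (hQ : Q.PosSemidef) (G : Matrix n n ℂ) :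
    0 ≤ ∑ i ∈ s, g i ^ 2 * (M i * Q).trace.re + 2 * ∑ i ∈ s, g i * (M i * (G * Q)).trace.re
      + (G * Q * Gᴴ).trace.re := by
  have hlast : (G * Q * Gᴴ).trace.re = ∑ i ∈ s, (M i * (G * Q * Gᴴ)).trace.re := by
    rw [← Complex.re_sum, ← Matrix.trace_sum, ← Finset.sum_mul, hsum, one_mul]
  rw [hlast, Finset.mul_sum, ← Finset.sum_add_distrib, ← Finset.sum_add_distrib]
  refine Finset.sum_nonneg fun i hi => ?_
  -- Each summand is `Tr (M i (g i + G) Q (g i + G)ᴴ)`, the quantum analogue of the expected square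
  -- of `g + G`.
  have h := trace_mul_nonneg (hM i hi)
    (hQ.mul_mul_conjTranspose_same (((g i : ℝ) : ℂ) • (1 : Matrix n n ℂ) + G))
  have hadj : (M i * (Q * Gᴴ)).trace.re = (M i * (G * Q)).trace.re := by
    have h1 : (M i * (G * Q))ᴴ = (Q * Gᴴ) * M i := by
      rw [Matrix.conjTranspose_mul, Matrix.conjTranspose_mul, hQ.isHermitian,
        (hM i hi).isHermitian]
    rw [Matrix.trace_mul_comm, ← h1, Matrix.trace_conjTranspose]
    simp
  have hexp : M i * ((((g i : ℝ) : ℂ) • (1 : Matrix n n ℂ) + G) * Q *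
      (((g i : ℝ) : ℂ) • (1 : Matrix n n ℂ) + G)ᴴ)
      = ((g i ^ 2 : ℝ) : ℂ) • (M i * Q) + ((g i : ℝ) : ℂ) • (M i * (G * Q))
        + ((g i : ℝ) : ℂ) • (M i * (Q * Gᴴ)) + M i * (G * Q * Gᴴ) := by
    simp only [Matrix.conjTranspose_add, Matrix.conjTranspose_smul, Matrix.conjTranspose_one,
      Complex.star_def, Complex.conj_ofReal, add_mul, mul_add, Matrix.smul_mul, Matrix.mul_smul,
      Matrix.one_mul, Matrix.mul_one]
    push_cast
    module
  rw [hexp] at h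
  simp only [Matrix.trace_add, Matrix.trace_smul, smul_eq_mul, Complex.add_re,
    Complex.re_ofReal_mul, hadj] at h
  linarith

theorem tensorPowMatrix_posSemidef (N : ℕ) {X : Matrix n n ℂ} (hX : X.PosSemidef) :
    (tensorPowMatrix N X).PosSemidef := by
  obtain ⟨B, hB⟩ := CStarAlgebra.nonneg_iff_eq_star_mul_self.mp
    (Matrix.nonneg_iff_posSemidef.mpr hX)
  rw [hB, tensorPowMatrix_mul, Matrix.star_eq_conjTranspose, tensorPowMatrix_conjTranspose]
  exact Matrix.posSemidef_conjTranspose_mul_self _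

/-- `A = T S⁻¹` acts as a likelihood ratio. Taking `G = A^{⊗N} - 1` and `Q = S^{⊗N}` in
`quadratic_nonneg` turns `G Q` into `T^{⊗N} - S^{⊗N}` and the last term into `(Tr (T S⁻¹ T))^N - 1`,
a χ²-divergence. -/
theorem quadratic_tensorPow_nonneg_of_posDef {ι : Type*} {N : ℕ} (s : Finset ι)
    (M : ι → Matrix (Fin N → n) (Fin N → n) ℂ)
    (hM : ∀ i ∈ s, (M i).PosSemidef) (hsum : ∑ i ∈ s, M i = 1) (g : ι → ℝ)
    {S T : Matrix n n ℂ} (hS : S.PosDef) (hT : T.IsHermitian) (hS1 : S.trace = 1)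
    (hT1 : T.trace = 1) {a : ℝ} (ha : 0 < a)
    (h₁ : ((a : ℂ) • S - (T - S)).PosSemidef) (h₂ : ((a : ℂ) • S + (T - S)).PosSemidef) :
    0 ≤ ∑ i ∈ s, g i ^ 2 * (M i * tensorPowMatrix N S).trace.re
      + 2 * ∑ i ∈ s, g i * (M i * (tensorPowMatrix N T - tensorPowMatrix N S)).trace.re
      + ((1 + a ^ 2) ^ N - 1) := by
  have hdet : IsUnit S.det := (Matrix.isUnit_iff_isUnit_det S).mp hS.isUnit
  have hSW : S * S⁻¹ = 1 := Matrix.mul_nonsing_inv _ hdet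
  have hWS : S⁻¹ * S = 1 := Matrix.nonsing_inv_mul _ hdet
  have hW : (S⁻¹)ᴴ = S⁻¹ := hS.isHermitian.inv
  have hchi := trace_mul_inv_mul_le hS ha h₁ h₂
  set A := T * S⁻¹ with hA
  have hAS : A * S = T := by rw [hA, Matrix.mul_assoc, hWS, Matrix.mul_one]
  have hSA : S * Aᴴ = T := by
    rw [hA, Matrix.conjTranspose_mul, hW, ← Matrix.mul_assoc, hSW, Matrix.one_mul, hT]
  have hASA : A * S * Aᴴ = (T - S) * S⁻¹ * (T - S) + T + T - S := by
    rw [hAS, hA, Matrix.conjTranspose_mul, hW, hT, ← Matrix.mul_assoc]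
    simp only [sub_mul, mul_sub, hSW, Matrix.one_mul]
    rw [Matrix.mul_assoc T S⁻¹ S, hWS, Matrix.mul_one]
    abel
  have htr : (A * S * Aᴴ).trace.re ≤ 1 + a ^ 2 := by
    rw [hASA]
    simp only [Matrix.trace_sub, Matrix.trace_add, hS1, hT1, Complex.sub_re, Complex.add_re,
      Complex.one_re] at hchi ⊢
    linarith
  have hpsd : (A * S * Aᴴ).PosSemidef := hS.posSemidef.mul_mul_conjTranspose_same A
  have hre : (A * S * Aᴴ).trace = ((A * S * Aᴴ).trace.re : ℂ) := by
    apply Complex.ext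
    · simp
    · simpa using (Complex.le_def.mp hpsd.trace_nonneg).2.symm
  have hnn : 0 ≤ (A * S * Aᴴ).trace.re := (Complex.le_def.mp hpsd.trace_nonneg).1
  have key := quadratic_nonneg s M hM hsum g (tensorPowMatrix_posSemidef N hS.posSemidef)
    (tensorPowMatrix N A - 1)
  have hG : (tensorPowMatrix N A - 1) * tensorPowMatrix N S
      = tensorPowMatrix N T - tensorPowMatrix N S := by
    rw [sub_mul, ← tensorPowMatrix_mul, hAS, one_mul]
  have hGG : ((tensorPowMatrix N A - 1) * tensorPowMatrix N S * (tensorPowMatrix N A - 1)ᴴ).trace.re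
      = (A * S * Aᴴ).trace.re ^ N - 1 := by
    rw [hG, Matrix.conjTranspose_sub, Matrix.conjTranspose_one, ← tensorPowMatrix_conjTranspose,
      mul_sub, mul_one, sub_mul, ← tensorPowMatrix_mul, ← tensorPowMatrix_mul, hSA, ← hAS]
    simp only [Matrix.trace_sub, tensorPowMatrix_trace]
    rw [hAS, hS1, hT1, ← hAS, hre, ← Complex.ofReal_pow]
    simp [-Complex.ofReal_pow]
  rw [hGG, hG] at key
  have hpow : (A * S * Aᴴ).trace.re ^ N ≤ (1 + a ^ 2) ^ N := pow_le_pow_left₀ hnn htr N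
  linarith

theorem continuous_tensorPowMatrix {m : Type} (N : ℕ) :
    Continuous (tensorPowMatrix N : Matrix m m ℂ → _) := by
  refine continuous_matrix fun i j => ?_
  simp only [tensorPowMatrix, Matrix.of_apply]
  exact continuous_finsetProd _ fun k _ => continuous_id.matrix_elem _ _

/-- The Chapman–Robbins inequality for `N` copies and a measurement with finitely many outcomes, in
quadratic form. -/
theorem quadratic_tensorPow_nonneg [Nonempty n] {ι : Type*} {N : ℕ} (s : Finset ι)
    (M : ι → Matrix (Fin N → n) (Fin N → n) ℂ)
    (hM : ∀ i ∈ s, (M i).PosSemidef) (hsum : ∑ i ∈ s, M i = 1) (g : ι → ℝ)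
    (S T : DensityOperator n) {a : ℝ} (ha : 0 < a)
    (h₁ : ((a : ℂ) • S.toMatrix - (T.toMatrix - S.toMatrix)).PosSemidef)
    (h₂ : ((a : ℂ) • S.toMatrix + (T.toMatrix - S.toMatrix)).PosSemidef) :
    0 ≤ ∑ i ∈ s, g i ^ 2 * (M i * (S.tensorPow N).toMatrix).trace.re
      + 2 * ∑ i ∈ s, g i * (M i * ((T.tensorPow N).toMatrix - (S.tensorPow N).toMatrix)).trace.re
      + ((1 + a ^ 2) ^ N - 1) := by
  -- The state `S` may be singular. Mixing weight `δ` of the maximally mixed state into both `S` and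
  -- `T` makes `S` invertible and preserves the two operator bounds with the same `a`; then `δ → 0`.
  set τ : Matrix n n ℂ := ((Fintype.card n : ℂ)⁻¹) • 1 with hτ
  have hcard : (0 : ℝ) < Fintype.card n := by exact_mod_cast Fintype.card_pos
  have hτ1 : τ.trace = 1 := by
    rw [hτ, Matrix.trace_smul, Matrix.trace_one, smul_eq_mul, inv_mul_cancel₀]
    exact_mod_cast hcard.ne'
  have hτP : τ.PosDef := by
    rw [hτ, show ((Fintype.card n : ℂ)⁻¹) = (((Fintype.card n : ℝ)⁻¹ : ℝ) : ℂ) by push_cast; rfl]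
    exact Matrix.PosDef.one.smul (Complex.zero_lt_real.mpr (inv_pos.mpr hcard))
  let mix : Matrix n n ℂ → ℝ → Matrix n n ℂ := fun X δ => ((1 - δ : ℝ) : ℂ) • X + (δ : ℂ) • τ
  have hmixc : ∀ X, Continuous (mix X) := fun X => by
    simp only [mix]
    exact ((Complex.continuous_ofReal.comp (by fun_prop)).smul continuous_const).add
      (Complex.continuous_ofReal.smul continuous_const)
  have hmix0 : ∀ X, mix X 0 = X := fun X => by simp [mix]
  have hmixtr : ∀ X δ, X.trace = 1 → (mix X δ).trace = 1 := fun X δ hX => by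
    simp [mix, Matrix.trace_add, Matrix.trace_smul, hX, hτ1]
  let F : ℝ → ℝ := fun δ =>
    ∑ i ∈ s, g i ^ 2 * (M i * tensorPowMatrix N (mix S.toMatrix δ)).trace.re
      + 2 * ∑ i ∈ s, g i * (M i * (tensorPowMatrix N (mix T.toMatrix δ)
        - tensorPowMatrix N (mix S.toMatrix δ))).trace.re
      + ((1 + a ^ 2) ^ N - 1)
  have hFc : Continuous F := by
    have hc : ∀ X, Continuous fun δ => tensorPowMatrix N (mix X δ) := fun X =>
      (continuous_tensorPowMatrix N).comp (hmixc X)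
    have h1 := hc S.toMatrix
    have h2 := hc T.toMatrix
    simp only [F]
    fun_prop
  have hF : ∀ δ ∈ Set.Ioo (0 : ℝ) 1, 0 ≤ F δ := by
    rintro δ ⟨h0, hl⟩
    have h0' : (0 : ℂ) < (δ : ℂ) := Complex.zero_lt_real.mpr h0
    have hl' : (0 : ℂ) ≤ ((1 - δ : ℝ) : ℂ) := Complex.zero_le_real.mpr (by linarith)
    have ha' : (0 : ℂ) ≤ ((a * δ : ℝ) : ℂ) := Complex.zero_le_real.mpr (by positivity)
    refine quadratic_tensorPow_nonneg_of_posDef s M hM hsum g ?_ ?_ (hmixtr _ _ S.trace_eq_one)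
      (hmixtr _ _ T.trace_eq_one) ha ?_ ?_
    · exact (hτP.smul h0').posSemidef_add (S.posSemidef.smul hl')
    · exact ((T.posSemidef.smul hl').add (hτP.posSemidef.smul h0'.le)).isHermitian
    · have := (h₁.smul hl').add (hτP.posSemidef.smul ha')
      convert this using 1
      simp only [mix]
      push_cast
      module
    · have := (h₂.smul hl').add (hτP.posSemidef.smul ha')
      convert this using 1
      simp only [mix]
      push_cast
      module
  have hlim : Tendsto F (𝓝[>] 0) (𝓝 (F 0)) := hFc.continuousAt.mono_left nhdsWithin_le_nhds
  have hge : 0 ≤ F 0 := ge_of_tendsto hlim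
    (Filter.mem_of_superset (Ioo_mem_nhdsGT one_pos) hF)
  simp only [F, hmix0] at hge
  exact hge

end Matrices

/-! ### From finitely many outcomes to arbitrary POVMs and estimators -/

section Measurements

variable {Ω : Type} [MeasurableSpace Ω] {n : Type} [Fintype n] [DecidableEq n]

instance POVM.isProbabilityMeasure_outcomeLaw (M : POVM Ω n) (ρ : DensityOperator n) :
    IsProbabilityMeasure (M.outcomeLaw ρ) where
  measure_univ := by
    rw [M.outcomeLaw_apply ρ MeasurableSet.univ, M.effect_univ, one_mul, ρ.trace_eq_one]
    simp

theorem POVM.outcomeLaw_real_apply (M : POVM Ω n) (ρ : DensityOperator n) {A : Set Ω}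
    (hA : MeasurableSet A) :
    (M.outcomeLaw ρ).real A = (M.effect A * ρ.toMatrix).trace.re := by
  rw [Measure.real, M.outcomeLaw_apply ρ hA,
    ENNReal.toReal_ofReal (trace_mul_nonneg (M.posSemidef A hA) ρ.posSemidef)]

theorem POVM.sum_effect_fiber (M : POVM Ω n) (g : SimpleFunc Ω ℝ) :
    ∑ y ∈ g.range, M.effect (g ⁻¹' {y}) = 1 := by
  rw [← M.effect_univ, ← VectorMeasure.of_biUnion_finset]
  · congr 1
    ext x
    simp
  · intro y _ z _ hyz
    exact Disjoint.preimage _ (by simpa using hyz)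
  · exact fun y _ => g.measurableSet_fiber y

/-- The fibres of a simple function coarse-grain the POVM to one with finitely many outcomes,
labelled by the values of `g`. -/
theorem POVM.quadratic_nonneg_simpleFunc [Nonempty n] {N : ℕ} (M : POVM Ω (Fin N → n))
    (S T : DensityOperator n) {a : ℝ} (ha : 0 < a)
    (h₁ : ((a : ℂ) • S.toMatrix - (T.toMatrix - S.toMatrix)).PosSemidef)
    (h₂ : ((a : ℂ) • S.toMatrix + (T.toMatrix - S.toMatrix)).PosSemidef)
    (g : SimpleFunc Ω ℝ) :
    0 ≤ ∫ x, g x ^ 2 ∂(M.outcomeLaw (S.tensorPow N))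
      + 2 * (∫ x, g x ∂(M.outcomeLaw (T.tensorPow N)) - ∫ x, g x ∂(M.outcomeLaw (S.tensorPow N)))
      + ((1 + a ^ 2) ^ N - 1) := by
  have hint : ∀ ρ : DensityOperator (Fin N → n), ∀ φ : ℝ → ℝ, φ 0 = 0 → ∫ x, φ (g x) ∂(M.outcomeLaw ρ)
      = ∑ y ∈ g.range, φ y * (M.effect (g ⁻¹' {y}) * ρ.toMatrix).trace.re := by
    intro ρ φ hφ
    rw [← g.map_integral φ (g.integrable_of_isFiniteMeasure) hφ |>.trans
      (Finset.sum_congr rfl fun y _ => by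
        rw [M.outcomeLaw_real_apply ρ (g.measurableSet_fiber y), smul_eq_mul, mul_comm])]
    exact ((g.map φ).integral_eq_integral (SimpleFunc.integrable_of_isFiniteMeasure _)).symm
  have key := quadratic_tensorPow_nonneg g.range (fun y => M.effect (g ⁻¹' {y}))
    (fun y _ => M.posSemidef _ (g.measurableSet_fiber y)) (M.sum_effect_fiber g) id S T ha h₁ h₂
  rw [hint _ (· ^ 2) (by simp), hint _ (fun y => y) rfl, hint _ (fun y => y) rfl, ← Finset.sum_sub_distrib]
  convert key using 6
  · rfl
  · simp [mul_sub, Matrix.trace_sub]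

/-- Simple functions bounded by `2 |f|` approximate `f` pointwise. Dominated convergence needs
square integrability only under the law of `S`, and mere integrability under that of `T`. -/
theorem POVM.quadratic_nonneg [Nonempty n] {N : ℕ} (M : POVM Ω (Fin N → n))
    (S T : DensityOperator n) {a : ℝ} (ha : 0 < a)
    (h₁ : ((a : ℂ) • S.toMatrix - (T.toMatrix - S.toMatrix)).PosSemidef)
    (h₂ : ((a : ℂ) • S.toMatrix + (T.toMatrix - S.toMatrix)).PosSemidef)
    {f : Ω → ℝ} (hf : Measurable f) (hfS : MemLp f 2 (M.outcomeLaw (S.tensorPow N)))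
    (hfT : Integrable f (M.outcomeLaw (T.tensorPow N))) :
    0 ≤ ∫ x, f x ^ 2 ∂(M.outcomeLaw (S.tensorPow N))
      + 2 * (∫ x, f x ∂(M.outcomeLaw (T.tensorPow N)) - ∫ x, f x ∂(M.outcomeLaw (S.tensorPow N)))
      + ((1 + a ^ 2) ^ N - 1) := by
  let g : ℕ → SimpleFunc Ω ℝ := SimpleFunc.approxOn f hf Set.univ 0 (Set.mem_univ 0)
  have hlim : ∀ x, Tendsto (fun k => g k x) atTop (𝓝 (f x)) := fun x =>
    SimpleFunc.tendsto_approxOn hf _ (by simp)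
  have hbd : ∀ k x, ‖g k x‖ ≤ 2 * ‖f x‖ := fun k x =>
    (SimpleFunc.norm_approxOn_zero_le hf (Set.mem_univ 0) x k).trans (by linarith)
  have hL1 : ∀ μ : Measure Ω, Integrable f μ →
      Tendsto (fun k => ∫ x, g k x ∂μ) atTop (𝓝 (∫ x, f x ∂μ)) := fun μ hμ =>
    tendsto_integral_of_dominated_convergence (fun x => 2 * ‖f x‖)
      (fun k => (g k).aestronglyMeasurable) (hμ.norm.const_mul 2)
      (fun k => ae_of_all _ (hbd k)) (ae_of_all _ hlim)
  have hL2 : Tendsto (fun k => ∫ x, g k x ^ 2 ∂(M.outcomeLaw (S.tensorPow N))) atTop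
      (𝓝 (∫ x, f x ^ 2 ∂(M.outcomeLaw (S.tensorPow N)))) := by
    refine tendsto_integral_of_dominated_convergence (fun x => 4 * f x ^ 2)
      (fun k => (g k).aestronglyMeasurable.pow 2) (hfS.integrable_sq.const_mul 4)
      (fun k => ae_of_all _ fun x => ?_) (ae_of_all _ fun x => (hlim x).pow 2)
    have h := pow_le_pow_left₀ (norm_nonneg _) (hbd k x) 2
    rw [norm_pow]
    refine h.trans_eq ?_
    rw [mul_pow, Real.norm_eq_abs, sq_abs]
    norm_num
  refine ge_of_tendsto' ((hL2.add (((hL1 _ hfT).sub (hL1 _ (hfS.integrable one_le_two))).const_mul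
    2)).add_const _) fun k => M.quadratic_nonneg_simpleFunc S T ha h₁ h₂ (g k)

/-- The Chapman–Robbins inequality for `N` copies. -/
theorem Estimator.sq_mean_sub_le [Nonempty n] {N : ℕ} (E : Estimator (Fin N → n))
    (S T : DensityOperator n) {a : ℝ} (ha : 0 < a)
    (h₁ : ((a : ℂ) • S.toMatrix - (T.toMatrix - S.toMatrix)).PosSemidef)
    (h₂ : ((a : ℂ) • S.toMatrix + (T.toMatrix - S.toMatrix)).PosSemidef)
    {θ α : ℝ} (hα : 0 ≤ α) (hmse : E.mse (S.tensorPow N) θ ≤ ENNReal.ofReal α)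
    (hmean : E.mean (S.tensorPow N) = θ)
    (hT : Integrable E.est (E.povm.outcomeLaw (T.tensorPow N))) :
    (E.mean (T.tensorPow N) - θ) ^ 2 ≤ α * ((1 + a ^ 2) ^ N - 1) := by
  have hmeas : Measurable fun x => E.est x - θ := E.measurable_est.sub_const θ
  set μ := E.povm.outcomeLaw (S.tensorPow N) with hμ
  have hlint : ∫⁻ x, ENNReal.ofReal ((E.est x - θ) ^ 2) ∂μ ≤ ENNReal.ofReal α := by
    refine le_of_eq_of_le (lintegral_congr fun x => ?_) hmse
    rw [← neg_sub, neg_sq]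
  have hsq : Integrable (fun x => (E.est x - θ) ^ 2) μ := by
    refine ⟨(hmeas.pow_const 2).aestronglyMeasurable, ?_⟩
    rw [hasFiniteIntegral_iff_ofReal (ae_of_all _ fun x => sq_nonneg _)]
    exact hlint.trans_lt ENNReal.ofReal_lt_top
  have hL2 : MemLp (fun x => E.est x - θ) 2 μ :=
    (memLp_two_iff_integrable_sq hmeas.aestronglyMeasurable).mpr hsq
  have hA : ∫ x, (E.est x - θ) ^ 2 ∂μ ≤ α := by
    rw [integral_eq_lintegral_of_nonneg_ae (ae_of_all _ fun x => sq_nonneg _)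
      hsq.aestronglyMeasurable]
    exact ENNReal.toReal_le_of_le_ofReal hα hlint
  have hS : Integrable E.est μ := by
    exact ((hL2.integrable one_le_two).add (integrable_const θ)).congr
      (ae_of_all _ fun x => by simp)
  have hB : ∫ x, (E.est x - θ) ∂(E.povm.outcomeLaw (T.tensorPow N)) - ∫ x, (E.est x - θ) ∂μ
      = E.mean (T.tensorPow N) - θ := by
    rw [integral_sub hT (integrable_const θ), integral_sub hS (integrable_const θ)]
    have : ∫ x, E.est x ∂μ = θ := hmean
    simp [Estimator.mean, this]
  set K := (1 + a ^ 2) ^ N - 1 with hK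
  have hK0 : 0 ≤ K := sub_nonneg.mpr (one_le_pow₀ (by nlinarith [sq_nonneg a]))
  -- Applying the inequality to every multiple `s (est - θ)` gives a quadratic in `s` that is never
  -- negative; its discriminant yields the claim.
  have hquad : ∀ s : ℝ, 0 ≤ (∫ x, (E.est x - θ) ^ 2 ∂μ) * (s * s)
      + 2 * (E.mean (T.tensorPow N) - θ) * s + K := by
    intro s
    have h := E.povm.quadratic_nonneg S T ha h₁ h₂ (hmeas.const_mul s) (hL2.const_mul s)
      ((hT.sub (integrable_const θ)).const_mul s)
    simp only [mul_pow, integral_const_mul, ← hμ] at h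
    rw [← mul_sub, hB] at h
    linarith
  have hd := discrim_le_zero hquad
  rw [discrim] at hd
  nlinarith [mul_le_mul_of_nonneg_right hA hK0]

end Measurements

/-! ### Privacy as an operator inequality, and contraction of Bloch vectors -/

/-- The self-duality of the cone of positive semidefinite matrices, tested on effects. -/
theorem posSemidef_of_forall_effect {n : Type} [Fintype n] [DecidableEq n] {X : Matrix n n ℂ}
    (hX : X.IsHermitian)
    (h : ∀ M : Matrix n n ℂ, M.PosSemidef → (1 - M).PosSemidef → 0 ≤ (M * X).trace.re) :
    X.PosSemidef := by
  rw [Matrix.posSemidef_iff_dotProduct_mulVec]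
  refine ⟨hX, fun v => ?_⟩
  set V := Matrix.vecMulVec v (star v) with hV
  have hVP : V.PosSemidef := Matrix.posSemidef_vecMulVec_self_star v
  -- This scaling makes `c V` an effect; the `+ 1` covers `v = 0`.
  set c : ℝ := (‖V‖ + 1)⁻¹ with hc
  have hc0 : 0 < c := inv_pos.mpr (by positivity)
  have hc0' : (0 : ℂ) < (c : ℂ) := Complex.zero_lt_real.mpr hc0
  have hVle : V ≤ algebraMap ℝ (Matrix n n ℂ) ‖V‖ :=
    IsSelfAdjoint.le_algebraMap_norm_self (a := V) hVP.isHermitian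
  have h1 : (1 - (c : ℂ) • V).PosSemidef := by
    have h2 : (algebraMap ℝ (Matrix n n ℂ) ‖V‖ - V).PosSemidef := Matrix.le_iff.mp hVle
    have h3 := (h2.add Matrix.PosSemidef.one).smul hc0'.le
    convert h3 using 1
    have h4 : (c : ℂ) * ((‖V‖ : ℂ) + 1) = 1 := by
      have : c * (‖V‖ + 1) = 1 := inv_mul_cancel₀ (by positivity)
      exact_mod_cast this
    have h5 : algebraMap ℝ (Matrix n n ℂ) ‖V‖ = (‖V‖ : ℂ) • 1 := by
      rw [Algebra.algebraMap_eq_smul_one]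
      ext i j
      simp
    rw [h5, sub_add_eq_add_sub, smul_sub, ← one_smul ℂ (1 : Matrix n n ℂ), smul_smul, ← add_smul,
      smul_smul, mul_one, h4]
  have h6 := h _ (hVP.smul hc0'.le) h1
  rw [Matrix.smul_mul, Matrix.trace_smul, smul_eq_mul, Complex.re_ofReal_mul] at h6
  have h7 : (V * X).trace = star v ⬝ᵥ (X *ᵥ v) := by
    rw [Matrix.trace_mul_comm, hV, Matrix.mul_vecMulVec, Matrix.trace_vecMulVec, dotProduct_comm]
  rw [h7] at h6
  refine Complex.le_def.mpr ⟨nonneg_of_mul_nonneg_right h6 hc0, ?_⟩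
  exact (hX.im_star_dotProduct_mulVec_self v).symm

/-- The scalar inequalities over all effects `M` amount to the operator inequality `𝓔(ρ) ≤ e^ε
𝓔(σ)`. -/
theorem LDP.posSemidef {ε : ℝ} {E : QubitChannel} (hE : E ∈ LDP ε) (ρ σ : Qubit) :
    ((Real.exp ε : ℂ) • (E.apply σ).toMatrix - (E.apply ρ).toMatrix).PosSemidef := by
  refine posSemidef_of_forall_effect ?_ fun M hM hM' => ?_
  · exact ((E.apply σ).posSemidef.smul
      (Complex.zero_le_real.mpr (Real.exp_pos ε).le)).isHermitian.sub
      (E.apply ρ).posSemidef.isHermitian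
  · have h := hE M hM hM' ρ σ
    rw [mul_sub, Matrix.mul_smul, Matrix.trace_sub, Matrix.trace_smul, smul_eq_mul, Complex.sub_re,
      Complex.re_ofReal_mul]
    linarith

/-- The matrix `v · σ̂`. -/
noncomputable def pauliSum (v : EuclideanSpace ℝ (Fin 3)) : Matrix (Fin 2) (Fin 2) ℂ :=
  ∑ i, (v i : ℂ) • pauli i

theorem pauliSum_smul (c : ℝ) (v : EuclideanSpace ℝ (Fin 3)) :
    pauliSum (c • v) = (c : ℂ) • pauliSum v := by
  simp only [pauliSum, Finset.smul_sum, smul_smul, PiLp.smul_apply, smul_eq_mul,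
    Complex.ofReal_mul]

theorem pauliSum_sub (v w : EuclideanSpace ℝ (Fin 3)) :
    pauliSum (v - w) = pauliSum v - pauliSum w := by
  simp [pauliSum, sub_smul]

theorem pauliSum_neg (v : EuclideanSpace ℝ (Fin 3)) : pauliSum (-v) = -pauliSum v := by
  simp [pauliSum]

theorem pauliSum_isHermitian (v : EuclideanSpace ℝ (Fin 3)) : (pauliSum v).IsHermitian := by
  ext i j
  fin_cases i <;> fin_cases j <;>
    simp [pauliSum, pauli, Fin.sum_univ_three, Matrix.conjTranspose_apply]

theorem pauliSum_trace (v : EuclideanSpace ℝ (Fin 3)) : (pauliSum v).trace = 0 := by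
  simp [pauliSum, pauli, Fin.sum_univ_three, Matrix.trace_fin_two]

theorem pauliSum_mul_self (v : EuclideanSpace ℝ (Fin 3)) :
    pauliSum v * pauliSum v = ((‖v‖ ^ 2 : ℝ) : ℂ) • 1 := by
  rw [EuclideanSpace.real_norm_sq_eq]
  ext i j
  fin_cases i <;> fin_cases j <;> apply Complex.ext <;>
    simp [pauliSum, pauli, Fin.sum_univ_three, Matrix.mul_apply, pow_two] <;> ring

theorem trace_pauliSum_mul (v : EuclideanSpace ℝ (Fin 3)) (ρ : Qubit) :
    (pauliSum v * ρ.toMatrix).trace.re = inner ℝ v (blochVector ρ) := by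
  rw [pauliSum, Finset.sum_mul, Matrix.trace_sum, Complex.re_sum, PiLp.inner_apply]
  refine Finset.sum_congr rfl fun i _ => ?_
  rw [Matrix.smul_mul, Matrix.trace_smul, smul_eq_mul, Complex.re_ofReal_mul]
  simp [blochVector, mul_comm]

/-- For a unit vector `(u · σ̂)² = 1`, so `1 + u · σ̂` is half its own square. -/
theorem one_add_pauliSum_posSemidef {u : EuclideanSpace ℝ (Fin 3)} (hu : ‖u‖ = 1) :
    (1 + pauliSum u).PosSemidef := by
  have h := (Matrix.posSemidef_conjTranspose_mul_self (1 + pauliSum u)).smul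
    (Complex.zero_le_real.mpr (show (0 : ℝ) ≤ 1 / 2 by norm_num))
  convert h using 1
  rw [Matrix.conjTranspose_add, Matrix.conjTranspose_one, pauliSum_isHermitian, add_mul, mul_add,
    mul_add, pauliSum_mul_self, hu]
  simp only [one_mul, mul_one]
  push_cast
  module

/-- The pure qubit state with Bloch vector `u`. -/
noncomputable def pureQubit (u : EuclideanSpace ℝ (Fin 3)) (hu : ‖u‖ = 1) : Qubit where
  toMatrix := (1 / 2 : ℂ) • (1 + pauliSum u)
  posSemidef := (one_add_pauliSum_posSemidef hu).smul (by norm_num [Complex.le_def])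
  trace_eq_one := by
    simp [Matrix.trace_smul, Matrix.trace_add, pauliSum_trace]

theorem sub_eq_smul_pureQubit_sub (ρ σ : Qubit) {r : ℝ} {u : EuclideanSpace ℝ (Fin 3)}
    (hu : ‖u‖ = 1) (h : blochVector ρ - blochVector σ = r • u) :
    ρ.toMatrix - σ.toMatrix = ((r / 2 : ℝ) : ℂ) • ((pureQubit u hu).toMatrix
      - (pureQubit (-u) (by rwa [norm_neg])).toMatrix) := by
  have h1 := congrArg pauliSum h
  rw [pauliSum_sub, pauliSum_smul] at h1
  rw [toMatrix_eq_bloch ρ, toMatrix_eq_bloch σ]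
  change (1 / 2 : ℂ) • (1 + pauliSum (blochVector ρ)) - (1 / 2 : ℂ) • (1 + pauliSum (blochVector σ))
    = _ • ((1 / 2 : ℂ) • (1 + pauliSum u) - (1 / 2 : ℂ) • (1 + pauliSum (-u)))
  rw [pauliSum_neg, ← smul_sub, add_sub_add_left_eq_sub, h1]
  push_cast
  module

/-- From `e^ε ≤ 1 + ε + ε²` and `e^{-ε} ≥ 1 - ε` the difference is at most `2ε + ε²`. -/
theorem exp_sub_exp_neg_le {ε : ℝ} (h0 : 0 < ε) (h1 : ε < 1) :
    Real.exp ε - Real.exp (-ε) ≤ 3 * ε := by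
  have h2 := Real.abs_exp_sub_one_sub_id_le (x := ε) (by rw [abs_of_pos h0]; exact h1.le)
  have h3 := Real.add_one_le_exp (-ε)
  have h4 := (abs_le.mp h2).2
  nlinarith

/-- A private channel contracts differences of states, relative to any of its outputs. -/
theorem LDP.posSemidef_smul_sub_sub {ε : ℝ} (hε : ε ∈ Set.Ioo (0 : ℝ) 1) {E : QubitChannel}
    (hE : E ∈ LDP ε) (ρ σ τ : Qubit) (hne : blochVector ρ ≠ blochVector σ) :
    (((3 / 2 * ε * ‖blochVector ρ - blochVector σ‖ : ℝ) : ℂ) • (E.apply τ).toMatrix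
      - ((E.apply ρ).toMatrix - (E.apply σ).toMatrix)).PosSemidef := by
  set v := blochVector ρ - blochVector σ with hv
  have hr : 0 < ‖v‖ := norm_pos_iff.mpr (sub_ne_zero.mpr hne)
  set u := ‖v‖⁻¹ • v with hu
  have hu1 : ‖u‖ = 1 := by
    rw [hu, norm_smul, norm_inv, norm_norm, inv_mul_cancel₀ hr.ne']
  have hvu : v = ‖v‖ • u := by rw [hu, smul_smul, mul_inv_cancel₀ hr.ne', one_smul]
  have h1 := congrArg E.toCP (sub_eq_smul_pureQubit_sub ρ σ hu1 (hv ▸ hvu))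
  rw [map_smul, map_sub, map_sub] at h1
  set p := pureQubit u hu1
  set q := pureQubit (-u) (by rwa [norm_neg])
  -- `𝓔(p) ≤ e^ε 𝓔(τ)` and `𝓔(q) ≥ e^{-ε} 𝓔(τ)`; `hS` supplies the slack up to `3ε`, and the factor
  -- `‖v‖ / 2` produces the constant `3/2`.
  have hp := LDP.posSemidef hE p τ
  have hq := (LDP.posSemidef hE τ q).smul (Complex.zero_le_real.mpr (Real.exp_pos (-ε)).le)
  have hS := (E.apply τ).posSemidef.smul (Complex.zero_le_real.mpr
    (sub_nonneg.mpr (exp_sub_exp_neg_le hε.1 hε.2)))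
  have h2 := ((hp.add hq).add hS).smul (Complex.zero_le_real.mpr (half_pos hr).le)
  convert h2 using 1
  have hexp : (Real.exp (-ε) : ℂ) * (Real.exp ε : ℂ) = 1 := by
    rw [← Complex.ofReal_mul, ← Real.exp_add]
    simp
  rw [smul_sub (Real.exp (-ε) : ℂ), smul_smul, hexp, one_smul]
  change _ - (E.toCP ρ.toMatrix - E.toCP σ.toMatrix) = _
  rw [h1]
  change _ - _ • ((E.apply p).toMatrix - (E.apply q).toMatrix) = _
  push_cast
  module

/-! ### The lower bound: passing to the limit `t → θ` -/

theorem hasDerivAt_blochVector {Θ : Set ℝ} (hΘ : IsOpen Θ) {ρ : ℝ → Qubit}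
    (hρ : ContDiffOn ℝ 1 (fun t => (ρ t).toMatrix) Θ) {θ : ℝ} (hθ : θ ∈ Θ) :
    HasDerivAt (fun t => blochVector (ρ t)) (deriv (fun t => blochVector (ρ t)) θ) θ := by
  have hd : DifferentiableAt ℝ (fun t => (ρ t).toMatrix) θ :=
    (hρ.differentiableOn one_ne_zero).differentiableAt (hΘ.mem_nhds hθ)
  refine DifferentiableAt.hasDerivAt ?_
  rw [differentiableAt_euclidean]
  intro i
  let L : Matrix (Fin 2) (Fin 2) ℂ →ₗ[ℝ] ℝ :=
    { toFun := fun X => (pauli i * X).trace.re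
      map_add' := fun X Y => by simp [mul_add, Matrix.trace_add]
      map_smul' := fun c X => by simp [Matrix.trace_smul] }
  exact (LinearMap.toContinuousLinearMap L).differentiableAt.comp θ hd

/-- Locally unbiased estimators for the output of a private channel need many copies. -/
theorem one_le_of_isUnbiasedAt {ρ : ℝ → Qubit} {θ : ℝ} {ω' : EuclideanSpace ℝ (Fin 3)}
    (hω' : HasDerivAt (fun t => blochVector (ρ t)) ω' θ) (hne : ω' ≠ 0)
    {α ε : ℝ} (hα : 0 < α) (hε : ε ∈ Set.Ioo (0 : ℝ) 1) {E : QubitChannel} (hE : E ∈ LDP ε)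
    {N : ℕ} (T : Estimator (Fin N → Fin 2))
    (hT : T.IsUnbiasedAt (fun t => (E.apply (ρ t)).tensorPow N) θ)
    (hmse : T.mse ((E.apply (ρ θ)).tensorPow N) θ ≤ ENNReal.ofReal α) :
    1 ≤ α * (9 / 4 * ε ^ 2 * ‖ω'‖ ^ 2 * N) := by
  obtain ⟨hint, hmean, hder⟩ := hT
  set m : ℝ → ℝ := fun t => T.mean ((E.apply (ρ t)).tensorPow N) with hm
  set b : ℝ → EuclideanSpace ℝ (Fin 3) := fun t => blochVector (ρ t) with hb
  have hmθ : m θ = θ := hmean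
  have hs1 : Tendsto (fun t => slope m θ t ^ 2) (𝓝[≠] θ) (𝓝 (1 ^ 2)) :=
    (hasDerivAt_iff_tendsto_slope.mp hder).pow 2
  have hs2 : Tendsto (fun t => ‖slope b θ t‖ ^ 2) (𝓝[≠] θ) (𝓝 (‖ω'‖ ^ 2)) :=
    (hasDerivAt_iff_tendsto_slope.mp hω').norm.pow 2
  have hb0 : Tendsto (fun t => ‖b t - b θ‖) (𝓝[≠] θ) (𝓝 0) := by
    have := ((hω'.continuousAt.tendsto.sub_const (b θ)).norm).mono_left
      (nhdsWithin_le_nhds (s := {θ}ᶜ))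
    simpa using this
  -- Writing `(1 + x)^N - 1 = x ∑ (1 + x)^i` isolates the factor `x = a²`, which is of order `(t -
  -- θ)²`; the remaining sum tends to `N`.
  have hgeom : Tendsto (fun t => ∑ i ∈ Finset.range N, (1 + (3 / 2 * ε * ‖b t - b θ‖) ^ 2) ^ i)
      (𝓝[≠] θ) (𝓝 (∑ i ∈ Finset.range N, (1 + (3 / 2 * ε * 0) ^ 2) ^ i)) :=
    tendsto_finsetSum _ fun i _ => ((((hb0.const_mul _).pow 2).const_add 1).pow i)
  have hrhs := ((hs2.const_mul (9 / 4 * ε ^ 2)).mul hgeom).const_mul α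
  have hle := le_of_tendsto_of_tendsto hs1 hrhs ?_
  · simpa using hle
  -- A nonzero derivative separates the Bloch vectors at `t` and `θ` for `t` near `θ`, so `a > 0`
  -- and the direction of their difference is defined.
  filter_upwards [hω'.eventually_ne hne (c := b θ), nhdsWithin_le_nhds hint, self_mem_nhdsWithin]
    with t htne htint ht
  have hpos : 0 < ‖b t - b θ‖ := norm_pos_iff.mpr (sub_ne_zero.mpr htne)
  have h1 := LDP.posSemidef_smul_sub_sub hε hE (ρ t) (ρ θ) (ρ θ) htne
  have h2 := LDP.posSemidef_smul_sub_sub hε hE (ρ θ) (ρ t) (ρ θ) htne.symm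
  rw [norm_sub_rev, ← neg_sub (E.apply (ρ t)).toMatrix, sub_neg_eq_add] at h2
  have h3 := T.sq_mean_sub_le (E.apply (ρ θ)) (E.apply (ρ t))
    (mul_pos (mul_pos (by norm_num) hε.1) hpos) h1 h2 hα.le hmse hmean htint
  have htθ : 0 < (t - θ) ^ 2 := by
    have : t - θ ≠ 0 := sub_ne_zero.mpr ht
    positivity
  have hgs := mul_geom_sum (1 + (3 / 2 * ε * ‖b t - b θ‖) ^ 2) N
  rw [add_sub_cancel_left] at hgs
  change (m t - θ) ^ 2 ≤ α * ((1 + (3 / 2 * ε * ‖b t - b θ‖) ^ 2) ^ N - 1) at h3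
  rw [← hgs] at h3
  have e1 : slope m θ t ^ 2 = (m t - θ) ^ 2 / (t - θ) ^ 2 := by
    rw [slope_def_field, hmθ, div_pow]
  have e2 : ‖slope b θ t‖ ^ 2 = ‖b t - b θ‖ ^ 2 / (t - θ) ^ 2 := by
    rw [slope_def_module, norm_smul, mul_pow, norm_inv, inv_pow, Real.norm_eq_abs, sq_abs]
    ring
  rw [e1, e2, div_le_iff₀ htθ]
  refine h3.trans_eq ?_
  generalize ∑ i ∈ Finset.range N, (1 + (3 / 2 * ε * ‖b t - b θ‖) ^ 2) ^ i = G
  generalize (t - θ) ^ 2 = d at htθ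
  field_simp
  ring

theorem C₁_nonneg (ω ω' : EuclideanSpace ℝ (Fin 3)) : 0 ≤ C₁ ω ω' := by
  rw [C₁]; positivity

/-- Only the summand `4` of the inverted bracket is used; the other is nonnegative. -/
theorem C₁_mul_le (ω ω' : EuclideanSpace ℝ (Fin 3)) : C₁ ω ω' * ‖ω'‖ ^ 2 ≤ 1 / 4 := by
  rw [C₁]
  rcases eq_or_ne ω' 0 with h | h
  · simp [h]
  have h0 : 0 < ‖ω'‖ := norm_pos_iff.mpr h
  have h1 : (4 + 1 / 4 * (‖ω'‖ ^ 2 / |inner ℝ ω' ω| ^ 2))⁻¹ ≤ 4⁻¹ :=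
    inv_anti₀ (by norm_num) (le_add_of_nonneg_right (by positivity))
  have h2 : 1 / ‖ω'‖ ^ 2 * (4 + 1 / 4 * (‖ω'‖ ^ 2 / |inner ℝ ω' ω| ^ 2))⁻¹ * ‖ω'‖ ^ 2
      = (4 + 1 / 4 * (‖ω'‖ ^ 2 / |inner ℝ ω' ω| ^ 2))⁻¹ := by
    field_simp
  rw [h2]
  linarith

theorem le_bestSampleComplexity {ρ : ℝ → Qubit} {θ : ℝ} {ω' : EuclideanSpace ℝ (Fin 3)}
    (hω' : HasDerivAt (fun t => blochVector (ρ t)) ω' θ) (hne : ω' ≠ 0)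
    (ω : EuclideanSpace ℝ (Fin 3))
    {α ε : ℝ} (hα : 0 < α) (hε : ε ∈ Set.Ioo (0 : ℝ) 1) :
    ENNReal.ofReal (C₁ ω ω' / (9 * α * ε ^ 2)) ≤ (bestSampleComplexity ρ θ α ε : ℝ≥0∞) := by
  set x := C₁ ω ω' / (9 * α * ε ^ 2) with hx
  have hε0 := hε.1
  -- Sample complexities are extended naturals, so the real bound is rounded up before it is
  -- compared with the infimum.
  have hceil : ((⌈x⌉₊ : ℕ) : ℕ∞) ≤ bestSampleComplexity ρ θ α ε := by
    refine le_iInf₂ fun E hE => le_iInf fun N => le_iInf fun _ => le_iInf fun ⟨T, hT, hmse⟩ => ?_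
    have h := one_le_of_isUnbiasedAt hω' hne hα hε hE T hT hmse
    have hC := C₁_mul_le ω ω'
    have hC0 := C₁_nonneg ω ω'
    rw [Nat.cast_le, Nat.ceil_le, hx, div_le_iff₀ (by positivity)]
    calc C₁ ω ω' = C₁ ω ω' * 1 := (mul_one _).symm
      _ ≤ C₁ ω ω' * (α * (9 / 4 * ε ^ 2 * ‖ω'‖ ^ 2 * N)) := mul_le_mul_of_nonneg_left h hC0
      _ = (C₁ ω ω' * ‖ω'‖ ^ 2) * (9 / 4 * α * ε ^ 2 * N) := by ring
      _ ≤ 1 / 4 * (9 / 4 * α * ε ^ 2 * N) := mul_le_mul_of_nonneg_right hC (by positivity)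
      _ ≤ N * (9 * α * ε ^ 2) := by
        have : 0 ≤ α * ε ^ 2 * N := by positivity
        nlinarith
  calc ENNReal.ofReal x ≤ ENNReal.ofReal (⌈x⌉₊ : ℝ) := ENNReal.ofReal_le_ofReal (Nat.le_ceil x)
    _ = (((⌈x⌉₊ : ℕ) : ℕ∞) : ℝ≥0∞) := by simp
    _ ≤ _ := ENat.toENNReal_le.mpr hceil

/-! ### Measure-and-prepare channels -/

/-- The completely positive map `X ↦ ∑ i, K i X (K i)ᴴ` with Kraus operators `K i`. -/
noncomputable def krausMap {n ι : Type} [Fintype n] [DecidableEq n] [Fintype ι]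
    (K : ι → Matrix n n ℂ) : Matrix n n ℂ →CP Matrix n n ℂ where
  toFun X := ∑ i, K i * X * (K i)ᴴ
  map_add' X Y := by simp [mul_add, add_mul, Finset.sum_add_distrib]
  map_smul' c X := by simp [Finset.smul_sum]
  map_cstarMatrix_nonneg' k M hM := by
    -- Amplifying the map to `k × k` blocks conjugates by the block-diagonal matrix with every block
    -- equal to `K i`, which preserves positivity.
    let D : ι → CStarMatrix (Fin k) (Fin k) (Matrix n n ℂ) := fun i =>
      CStarMatrix.ofMatrix (Matrix.diagonal fun _ => K i)
    have h : 0 ≤ ∑ i, D i * M * star (D i) :=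
      Finset.sum_nonneg fun i _ => star_right_conjugate_nonneg hM (D i)
    convert h using 1
    ext1 a b
    have hsum : (∑ i, D i * M * star (D i)) a b = ∑ i, (D i * M * star (D i)) a b := by
      change (∑ i, (show Matrix (Fin k) (Fin k) (Matrix n n ℂ) from D i * M * star (D i))) a b = _
      rw [Matrix.sum_apply]
    rw [hsum]
    change ∑ i, K i * M a b * (K i)ᴴ = _
    refine Finset.sum_congr rfl fun i _ => ?_
    change _ = (Matrix.diagonal (fun _ : Fin k => K i) * (show Matrix _ _ _ from M)
      * (Matrix.diagonal fun _ : Fin k => K i)ᴴ) a b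
    rw [Matrix.diagonal_conjTranspose, Matrix.mul_diagonal, Matrix.diagonal_mul]
    rfl

theorem krausMap_apply {n ι : Type} [Fintype n] [DecidableEq n] [Fintype ι]
    (K : ι → Matrix n n ℂ) (X : Matrix n n ℂ) : krausMap K X = ∑ i, K i * X * (K i)ᴴ := rfl

/-- Measuring a two-outcome POVM and recording the outcome in the computational basis is a
channel. -/
theorem exists_measure_prepare_channel (M : Fin 2 → Matrix (Fin 2) (Fin 2) ℂ)
    (hM : ∀ b, (M b).PosSemidef) (hsum : ∑ b, M b = 1) :
    ∃ E : QubitChannel, ∀ X, E.toCP X = Matrix.diagonal fun b => (M b * X).trace := by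
  have hB : ∀ b, ∃ B : Matrix (Fin 2) (Fin 2) ℂ, M b = Bᴴ * B := fun b =>
    CStarAlgebra.nonneg_iff_eq_star_mul_self.mp (Matrix.nonneg_iff_posSemidef.mpr (hM b))
  choose B hB using hB
  -- With `M b = (B b)ᴴ (B b)`, the Kraus operators are `|b⟩⟨c| B b`; summing over `c` produces the
  -- trace and leaves `|b⟩⟨b|`.
  let φ := krausMap fun i : Fin 2 × Fin 2 => Matrix.single i.1 i.2 1 * B i.1
  have hφ : ∀ X, φ X = Matrix.diagonal fun b => (M b * X).trace := by
    intro X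
    have h1 : ∀ b, (M b * X).trace = (B b * X * (B b)ᴴ).trace := fun b => by
      rw [hB b, Matrix.mul_assoc, Matrix.trace_mul_comm]
    simp only [φ, krausMap_apply, h1]
    rw [Fintype.sum_prod_type]
    have h2 : ∀ b c, Matrix.single b c 1 * B b * X * (Matrix.single b c 1 * B b)ᴴ
        = Matrix.single b b ((B b * X * (B b)ᴴ) c c) := fun b c => by
      rw [Matrix.conjTranspose_mul, Matrix.conjTranspose_single, star_one]
      simp only [← Matrix.mul_assoc]
      rw [Matrix.mul_assoc _ (B b), Matrix.mul_assoc _ (B b * X), Matrix.single_mul_mul_single]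
      simp
    simp only [h2]
    ext i j
    fin_cases i <;> fin_cases j <;> simp [Matrix.trace_fin_two, Fin.sum_univ_two, Matrix.single]
  refine ⟨⟨φ, fun X => ?_⟩, hφ⟩
  rw [hφ, Matrix.trace_diagonal, ← Matrix.trace_sum, ← Finset.sum_mul, hsum, one_mul]

/-! ### Computational-basis measurements, and moments of independent outcomes -/

section ComputationalBasis

variable {n : Type} [Fintype n] [DecidableEq n] [MeasurableSpace n] [MeasurableSingletonClass n]

/-- The measurement in the computational basis. -/
noncomputable def basisPOVM (n : Type) [Fintype n] [DecidableEq n] [MeasurableSpace n]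
    [MeasurableSingletonClass n] : POVM n n where
  effect := ∑ x, VectorMeasure.dirac x (Matrix.single x x 1)
  posSemidef A hA := by
    rw [FunLike.coe_sum, Finset.sum_apply]
    refine Matrix.posSemidef_sum _ fun x _ => ?_
    by_cases hx : x ∈ A
    · rw [VectorMeasure.dirac_apply_of_mem hA hx, ← Matrix.diagonal_single]
      exact Matrix.PosSemidef.diagonal (by simp)
    · rw [VectorMeasure.dirac_apply_of_notMem hx]
      exact Matrix.PosSemidef.zero
  effect_univ := by
    rw [FunLike.coe_sum, Finset.sum_apply, Finset.sum_congr rfl fun x _ =>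
      VectorMeasure.dirac_apply_of_mem MeasurableSet.univ (Set.mem_univ x)]
    ext i j
    rcases eq_or_ne i j with rfl | hij
    · simp [Matrix.sum_apply, Matrix.single_apply]
    · rw [Matrix.sum_apply, Matrix.one_apply_ne hij]
      refine Finset.sum_eq_zero fun x _ => Matrix.single_apply_of_ne _ _ _ _ _ ?_
      rintro ⟨rfl, rfl⟩
      exact hij rfl

theorem basisPOVM_outcomeLaw_real_singleton (ρ : DensityOperator n) (x : n) :
    ((basisPOVM n).outcomeLaw ρ).real {x} = (ρ.toMatrix x x).re := by
  rw [POVM.outcomeLaw_real_apply _ _ (measurableSet_singleton x)]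
  have : (basisPOVM n).effect {x} = Matrix.single x x 1 := by
    change (∑ y, VectorMeasure.dirac y (Matrix.single y y 1) : VectorMeasure n _) {x} = _
    rw [FunLike.coe_sum, Finset.sum_apply, Finset.sum_eq_single x]
    · exact VectorMeasure.dirac_apply_of_mem (measurableSet_singleton x) rfl
    · exact fun y _ hy => VectorMeasure.dirac_apply_of_notMem (by simpa using hy)
    · simp
  rw [this]
  simp [Matrix.trace_single_mul]

theorem integral_basisPOVM_outcomeLaw (ρ : DensityOperator n) (f : n → ℝ) :
    ∫ x, f x ∂((basisPOVM n).outcomeLaw ρ) = ∑ x, (ρ.toMatrix x x).re * f x := by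
  rw [integral_fintype Integrable.of_finite]
  simp only [basisPOVM_outcomeLaw_real_singleton, smul_eq_mul]

end ComputationalBasis

theorem DensityOperator.sum_re_diag {n : Type} [Fintype n] (ρ : DensityOperator n) :
    ∑ b, (ρ.toMatrix b b).re = 1 := by
  have := congrArg Complex.re ρ.trace_eq_one
  simpa [Matrix.trace] using this

theorem DensityOperator.tensorPow_diag_re {n : Type} [Fintype n] (N : ℕ) (ρ : DensityOperator n)
    (x : Fin N → n) :
    ((ρ.tensorPow N).toMatrix x x).re = ∏ k, (ρ.toMatrix (x k) (x k)).re := by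
  have h : ∀ b, ρ.toMatrix b b = ((ρ.toMatrix b b).re : ℂ) := fun b =>
    (ρ.posSemidef.isHermitian.coe_re_apply_self b).symm
  change (∏ k, ρ.toMatrix (x k) (x k)).re = _
  rw [Finset.prod_congr rfl fun k _ => h (x k), ← Complex.ofReal_prod, Complex.ofReal_re]

section ProductSums

variable {β : Type*} [Fintype β]

theorem sum_fin_succ_fun {N : ℕ} (F : (Fin (N + 1) → β) → ℝ) :
    ∑ x, F x = ∑ b, ∑ x, F (Fin.cons b x) := by
  rw [← (Fin.consEquiv fun _ : Fin (N + 1) => β).sum_comp, Fintype.sum_prod_type]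
  rfl

theorem sum_prod_eq_one {p : β → ℝ} (hp : ∑ b, p b = 1) (N : ℕ) :
    ∑ x : Fin N → β, ∏ k, p (x k) = 1 := by
  induction N with
  | zero => simp
  | succ N ih =>
    simp only [sum_fin_succ_fun, Fin.prod_univ_succ, Fin.cons_zero, Fin.cons_succ,
      ← Finset.mul_sum, ih, mul_one, hp]

theorem sum_prod_mul_sum {p : β → ℝ} (hp : ∑ b, p b = 1) (y : β → ℝ) (N : ℕ) :
    ∑ x : Fin N → β, (∏ k, p (x k)) * ∑ k, y (x k) = N * ∑ b, p b * y b := by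
  induction N with
  | zero => simp
  | succ N ih =>
    simp only [sum_fin_succ_fun, Fin.prod_univ_succ, Fin.sum_univ_succ, Fin.cons_zero,
      Fin.cons_succ]
    have h : ∀ b, ∑ x : Fin N → β, p b * (∏ k, p (x k)) * (y b + ∑ k, y (x k))
        = p b * y b + p b * (N * ∑ b, p b * y b) := fun b => by
      simp only [mul_add, Finset.sum_add_distrib, mul_assoc, ← Finset.mul_sum, ih]
      simp only [mul_comm _ (y b), ← Finset.mul_sum, sum_prod_eq_one hp, mul_one]
    simp only [h, Finset.sum_add_distrib, ← Finset.sum_mul, hp]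
    push_cast
    ring

/-- Additivity of variance for independent centred variables: the cross terms vanish by `hy`. -/
theorem sum_prod_mul_sum_sq {p : β → ℝ} (hp : ∑ b, p b = 1) {y : β → ℝ}
    (hy : ∑ b, p b * y b = 0) (N : ℕ) :
    ∑ x : Fin N → β, (∏ k, p (x k)) * (∑ k, y (x k)) ^ 2 = N * ∑ b, p b * y b ^ 2 := by
  induction N with
  | zero => simp
  | succ N ih =>
    simp only [sum_fin_succ_fun, Fin.prod_univ_succ, Fin.sum_univ_succ, Fin.cons_zero,
      Fin.cons_succ]
    have h : ∀ b, ∑ x : Fin N → β, p b * (∏ k, p (x k)) * (y b + ∑ k, y (x k)) ^ 2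
        = p b * y b ^ 2 + p b * (N * ∑ b, p b * y b ^ 2) := fun b => by
      have h1 : ∀ x : Fin N → β, p b * (∏ k, p (x k)) * (y b + ∑ k, y (x k)) ^ 2
          = (p b * y b ^ 2) * (∏ k, p (x k)) + (2 * p b * y b) * ((∏ k, p (x k)) * ∑ k, y (x k))
            + p b * ((∏ k, p (x k)) * (∑ k, y (x k)) ^ 2) := fun x => by ring
      simp only [h1, Finset.sum_add_distrib, ← Finset.mul_sum, ih, sum_prod_eq_one hp,
        sum_prod_mul_sum hp, hy]
      ring
    simp only [h, Finset.sum_add_distrib, ← Finset.sum_mul, hp]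
    push_cast
    ring

end ProductSums

/-! ### The upper bound: private channel and linear estimator -/

/-- Estimate by the rescaled sum `θ + c ∑ₖ y(xₖ)` of the outcomes `xₖ` of measuring the
computational basis on each copy. -/
noncomputable def linearEstimator (N : ℕ) (θ c : ℝ) (y : Fin 2 → ℝ) :
    Estimator (Fin N → Fin 2) where
  Outcome := Fin N → Fin 2
  povm := basisPOVM _
  est x := θ + c * ∑ k, y (x k)
  measurable_est := measurable_of_finite _

theorem linearEstimator_mean (N : ℕ) (θ c : ℝ) (y : Fin 2 → ℝ) (ρ : Qubit) :
    (linearEstimator N θ c y).mean (ρ.tensorPow N)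
      = θ + c * (N * ∑ b, (ρ.toMatrix b b).re * y b) := by
  change ∫ x : Fin N → Fin 2, (θ + c * ∑ k, y (x k)) ∂((basisPOVM _).outcomeLaw _) = _
  rw [integral_basisPOVM_outcomeLaw]
  simp only [ρ.tensorPow_diag_re, mul_add, Finset.sum_add_distrib, ← Finset.sum_mul,
    sum_prod_eq_one ρ.sum_re_diag, mul_left_comm _ c, ← Finset.mul_sum,
    sum_prod_mul_sum ρ.sum_re_diag, one_mul]

theorem linearEstimator_mse (N : ℕ) (θ c : ℝ) {y : Fin 2 → ℝ} {ρ : Qubit}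
    (hy : ∑ b, (ρ.toMatrix b b).re * y b = 0) :
    (linearEstimator N θ c y).mse (ρ.tensorPow N) θ
      = ENNReal.ofReal (c ^ 2 * (N * ∑ b, (ρ.toMatrix b b).re * y b ^ 2)) := by
  change ∫⁻ x : Fin N → Fin 2, ENNReal.ofReal ((θ - (θ + c * ∑ k, y (x k))) ^ 2)
    ∂((basisPOVM _).outcomeLaw _) = _
  rw [← ofReal_integral_eq_lintegral_ofReal Integrable.of_finite (ae_of_all _ fun _ => sq_nonneg _),
    integral_basisPOVM_outcomeLaw]
  simp only [ρ.tensorPow_diag_re, sub_add_cancel_left, neg_sq, mul_pow, mul_left_comm _ (c ^ 2),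
    ← Finset.mul_sum, sum_prod_mul_sum_sq ρ.sum_re_diag hy]

/-- For a unit vector `u`, some `ε`-private channel outputs `(I + (2 ε / 5) ⟨u, ω⟩ σ_z) / 2` in the
computational basis on input of Bloch vector `ω`. -/
theorem exists_LDP_channel {ε : ℝ} (hε : ε ∈ Set.Ioo (0 : ℝ) 1) {u : EuclideanSpace ℝ (Fin 3)}
    (hu : ‖u‖ = 1) :
    ∃ E ∈ LDP ε, ∀ ρ : Qubit,
      ((E.apply ρ).toMatrix 0 0).re = (1 + 2 / 5 * ε * inner ℝ u (blochVector ρ)) / 2 ∧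
      ((E.apply ρ).toMatrix 1 1).re = (1 - 2 / 5 * ε * inner ℝ u (blochVector ρ)) / 2 := by
  obtain ⟨h0, h1⟩ := hε
  set q : ℝ := 2 / 5 * ε with hq
  let M : Fin 2 → Matrix (Fin 2) (Fin 2) ℂ := ![((1 / 2 : ℝ) : ℂ) • (1 + (q : ℂ) • pauliSum u),
    ((1 / 2 : ℝ) : ℂ) • (1 - (q : ℂ) • pauliSum u)]
  have hP := one_add_pauliSum_posSemidef hu
  have hP' := one_add_pauliSum_posSemidef (u := -u) (by rwa [norm_neg])
  have hM : ∀ b, (M b).PosSemidef := by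
    have hA : ∀ v : EuclideanSpace ℝ (Fin 3), (1 + pauliSum v).PosSemidef →
        (((1 / 2 : ℝ) : ℂ) • (1 + (q : ℂ) • pauliSum v)).PosSemidef := fun v hv => by
      have h2 := ((Matrix.PosSemidef.one (n := Fin 2) (R := ℂ)).smul (Complex.zero_le_real.mpr
        (show (0 : ℝ) ≤ (1 - q) / 2 by rw [hq]; linarith))).add (hv.smul (Complex.zero_le_real.mpr
        (show (0 : ℝ) ≤ q / 2 by rw [hq]; linarith)))
      convert h2 using 1
      push_cast
      module
    intro b
    fin_cases b
    · exact hA u hP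
    · have := hA (-u) hP'
      rw [pauliSum_neg, smul_neg, ← sub_eq_add_neg] at this
      exact this
  have hsum : ∑ b, M b = 1 := by
    simp only [M, Fin.sum_univ_two, Matrix.cons_val_zero, Matrix.cons_val_one]
    push_cast
    module
  obtain ⟨E, hE⟩ := exists_measure_prepare_channel M hM hsum
  have htr : ∀ ρ : Qubit,
      (M 0 * ρ.toMatrix).trace.re = (1 + q * inner ℝ u (blochVector ρ)) / 2 ∧
      (M 1 * ρ.toMatrix).trace.re = (1 - q * inner ℝ u (blochVector ρ)) / 2 := fun ρ => by
    simp only [M, Matrix.cons_val_zero, Matrix.cons_val_one, Matrix.smul_mul, add_mul, sub_mul,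
      one_mul, Matrix.trace_smul, Matrix.trace_add, Matrix.trace_sub, smul_eq_mul,
      Complex.re_ofReal_mul, Complex.add_re, Complex.sub_re, ρ.trace_eq_one, trace_pauliSum_mul,
      Complex.one_re]
    constructor <;> ring
  have hbd : ∀ ρ : Qubit, |inner ℝ u (blochVector ρ)| ≤ 1 := fun ρ => by
    have h2 := trace_mul_nonneg hP ρ.posSemidef
    have h3 := trace_mul_nonneg hP' ρ.posSemidef
    simp only [add_mul, one_mul, Matrix.trace_add, Complex.add_re, ρ.trace_eq_one,
      trace_pauliSum_mul, Complex.one_re, inner_neg_left] at h2 h3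
    exact abs_le.mpr ⟨by linarith, by linarith⟩
  -- The outcome probabilities lie between `(1 - q) / 2` and `(1 + q) / 2`, so this is exactly the
  -- worst-case privacy ratio. With `q = 2ε/5` it follows from `1 + ε + ε²/2 ≤ e^ε`.
  have hexp : 1 + q ≤ Real.exp ε * (1 - q) := by
    have h2 := Real.quadratic_le_exp_of_nonneg h0.le
    have h3 : (1 + ε + ε ^ 2 / 2) * (1 - q) ≤ Real.exp ε * (1 - q) :=
      mul_le_mul_of_nonneg_right h2 (by rw [hq]; linarith)
    have h4 : 0 ≤ ε ^ 2 * (1 - ε) := mul_nonneg (sq_nonneg _) (by linarith)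
    refine le_trans ?_ h3
    rw [hq]
    nlinarith
  refine ⟨E, ?_, fun ρ => ?_⟩
  · intro L hL _ ρ σ
    -- The output is diagonal, so an effect acts through its diagonal entries alone and privacy can
    -- be checked outcome by outcome.
    have hexpand : ∀ τ : Qubit, (L * (E.apply τ).toMatrix).trace.re
        = (L 0 0).re * ((1 + q * inner ℝ u (blochVector τ)) / 2)
          + (L 1 1).re * ((1 - q * inner ℝ u (blochVector τ)) / 2) := fun τ => by
      change (L * E.toCP τ.toMatrix).trace.re = _
      have him : ∀ b, (L b b).im = 0 := fun b => (Complex.le_def.mp (hL.diag_nonneg (i := b))).2.symm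
      rw [hE, ← (htr τ).1, ← (htr τ).2, Matrix.trace_fin_two]
      simp [Matrix.mul_diagonal, him]
    have hL0 : ∀ b, 0 ≤ (L b b).re := fun b => (Complex.le_def.mp (hL.diag_nonneg (i := b))).1
    rw [hexpand, hexpand, mul_add]
    obtain ⟨hρ1, hρ2⟩ := abs_le.mp (hbd ρ)
    obtain ⟨hσ1, hσ2⟩ := abs_le.mp (hbd σ)
    have hq0 : 0 ≤ q := by rw [hq]; linarith
    have hcmp : ∀ x y : ℝ, x ≤ 1 → -1 ≤ y →
        (1 + q * x) / 2 ≤ Real.exp ε * ((1 + q * y) / 2) := fun x y hx hy => by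
      have h2 : q * x ≤ q * 1 := mul_le_mul_of_nonneg_left hx hq0
      have h3 : Real.exp ε * (1 - q) ≤ Real.exp ε * (1 + q * y) :=
        mul_le_mul_of_nonneg_left (by nlinarith) (Real.exp_pos ε).le
      linarith
    have c0 := mul_le_mul_of_nonneg_left (hcmp _ _ hρ2 hσ1) (hL0 0)
    -- The second outcome is the first one with the sign of the bias reversed.
    have c1 := mul_le_mul_of_nonneg_left (hcmp (-inner ℝ u (blochVector ρ))
      (-inner ℝ u (blochVector σ)) (by linarith) (by linarith)) (hL0 1)
    rw [mul_neg, mul_neg, ← sub_eq_add_neg, ← sub_eq_add_neg] at c1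
    rw [mul_left_comm, mul_left_comm (Real.exp ε)]
    exact add_le_add c0 c1
  · change ((E.toCP ρ.toMatrix) 0 0).re = _ ∧ ((E.toCP ρ.toMatrix) 1 1).re = _
    rw [hE, Matrix.diagonal_apply_eq, Matrix.diagonal_apply_eq]
    exact htr ρ

theorem bestSampleComplexity_le_of_le {ρ : ℝ → Qubit} {θ : ℝ} {ω' : EuclideanSpace ℝ (Fin 3)}
    (hω' : HasDerivAt (fun t => blochVector (ρ t)) ω' θ) (hne : ω' ≠ 0)
    {α ε : ℝ} (hα : 0 < α) (hε : ε ∈ Set.Ioo (0 : ℝ) 1) {N : ℕ} (hN : 1 ≤ N)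
    (hNle : 25 / (4 * α * ε ^ 2 * ‖ω'‖ ^ 2) ≤ N) :
    bestSampleComplexity ρ θ α ε ≤ N := by
  have hε0 := hε.1
  have hn : 0 < ‖ω'‖ := norm_pos_iff.mpr hne
  have hN0 : (0 : ℝ) < N := by exact_mod_cast hN
  set u := ‖ω'‖⁻¹ • ω' with hu
  have hu1 : ‖u‖ = 1 := by rw [hu, norm_smul, norm_inv, norm_norm, inv_mul_cancel₀ hn.ne']
  have huω' : inner ℝ u ω' = ‖ω'‖ := by
    rw [hu, real_inner_smul_left, real_inner_self_eq_norm_sq, pow_two, inv_mul_cancel_left₀ hn.ne']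
  obtain ⟨E, hE, hEout⟩ := exists_LDP_channel hε hu1
  set q : ℝ := 2 / 5 * ε with hq
  have hq0 : 0 < q := by positivity
  set m : ℝ := q * inner ℝ u (blochVector (ρ θ)) with hm
  -- The sum of the bits has mean with derivative `N q ‖ω'‖` at `θ`; this `c` normalises it to `1`.
  -- The shift by `m` in `y` centres the outcomes `±1` at `θ`, leaving variance `1 - m² ≤ 1` per
  -- copy.
  set c : ℝ := 1 / (N * q * ‖ω'‖) with hc
  let y : Fin 2 → ℝ := ![1 - m, -1 - m]
  have hy1 : ∀ t, ∑ b, ((E.apply (ρ t)).toMatrix b b).re * y b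
      = q * inner ℝ u (blochVector (ρ t)) - m := fun t => by
    rw [Fin.sum_univ_two, (hEout (ρ t)).1, (hEout (ρ t)).2]
    simp only [y, Matrix.cons_val_zero, Matrix.cons_val_one]
    ring
  have hy0 : ∑ b, ((E.apply (ρ θ)).toMatrix b b).re * y b = 0 := by rw [hy1, hm, sub_self]
  have hy2 : ∑ b, ((E.apply (ρ θ)).toMatrix b b).re * y b ^ 2 = 1 - m ^ 2 := by
    rw [Fin.sum_univ_two, (hEout (ρ θ)).1, (hEout (ρ θ)).2, ← hm]
    simp only [y, Matrix.cons_val_zero, Matrix.cons_val_one]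
    ring
  refine (iInf₂_le E hE).trans ((iInf₂_le N hN).trans (iInf_le _ ⟨linearEstimator N θ c y, ?_, ?_⟩))
  · refine ⟨Eventually.of_forall fun t => ?_, ?_, ?_⟩
    · change Integrable _ ((basisPOVM (Fin N → Fin 2)).outcomeLaw _)
      exact Integrable.of_finite
    · simp only [linearEstimator_mean, hy0, mul_zero, add_zero]
    · simp only [linearEstimator_mean, hy1]
      have hin : HasDerivAt (fun t => inner ℝ u (blochVector (ρ t))) ‖ω'‖ θ := by
        have := (innerSL ℝ u).hasFDerivAt.comp_hasDerivAt θ hω'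
        rwa [innerSL_apply_apply, huω'] at this
      have hder := ((((hin.const_mul q).sub_const m).const_mul (N : ℝ)).const_mul c).const_add θ
      refine hder.congr_deriv ?_
      rw [hc]
      field_simp
  · rw [linearEstimator_mse N θ c hy0, hy2]
    refine ENNReal.ofReal_le_ofReal ?_
    have h1 : c ^ 2 * (N * (1 - m ^ 2)) ≤ c ^ 2 * (N * 1) := by
      have := sq_nonneg m
      gcongr
      linarith
    refine h1.trans ?_
    rw [div_le_iff₀ (by positivity)] at hNle
    have h2 : c ^ 2 * (N * 1) = 25 / (4 * N * ε ^ 2 * ‖ω'‖ ^ 2) := by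
      rw [hc, hq]
      field_simp
      norm_num
    rw [h2, div_le_iff₀ (by positivity)]
    linarith

theorem bestSampleComplexity_le {ρ : ℝ → Qubit} {θ : ℝ} {ω' : EuclideanSpace ℝ (Fin 3)}
    (hω' : HasDerivAt (fun t => blochVector (ρ t)) ω' θ) (hne : ω' ≠ 0)
    {α ε : ℝ} (hα : 0 < α) (hε : ε ∈ Set.Ioo (0 : ℝ) 1) :
    (bestSampleComplexity ρ θ α ε : ℝ≥0∞) ≤
      ENNReal.ofReal (max 1 (C₂ ω' * (Real.exp 1 + 1) ^ 2 / (α * ε ^ 2))) := by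
  have hε0 := hε.1
  have hn : 0 < ‖ω'‖ := norm_pos_iff.mpr hne
  set Y : ℝ := 25 / (4 * α * ε ^ 2 * ‖ω'‖ ^ 2) with hY
  have hY0 : 0 < Y := by positivity
  have h1 := bestSampleComplexity_le_of_le hω' hne hα hε (Nat.one_le_ceil_iff.mpr hY0)
    (Nat.le_ceil Y)
  have h2 : (⌈Y⌉₊ : ℝ) ≤ max 1 (C₂ ω' * (Real.exp 1 + 1) ^ 2 / (α * ε ^ 2)) := by
    have h3 : C₂ ω' * (Real.exp 1 + 1) ^ 2 / (α * ε ^ 2) = (Real.exp 1 + 1) ^ 2 * (4 / 25) * Y := by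
      rw [C₂, hY]
      field_simp
    -- The target is at least `2Y`, which absorbs the rounding: `⌈Y⌉ < Y + 1 < 2Y` when `Y > 1`.
    -- When `Y ≤ 1` a single copy suffices, whence the maximum with `1`.
    have h4 : 2 ≤ (Real.exp 1 + 1) ^ 2 * (4 / 25) := by
      have := Real.exp_one_gt_d9
      nlinarith
    rcases le_or_gt Y 1 with h | h
    · refine le_max_of_le_left ?_
      exact_mod_cast Nat.ceil_le.mpr (by simpa using h)
    · refine le_max_of_le_right ?_
      rw [h3]
      have := Nat.ceil_lt_add_one hY0.le
      nlinarith
  calc (bestSampleComplexity ρ θ α ε : ℝ≥0∞) ≤ (((⌈Y⌉₊ : ℕ) : ℕ∞) : ℝ≥0∞) :=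
        ENat.toENNReal_le.mpr h1
    _ = ENNReal.ofReal (⌈Y⌉₊ : ℝ) := by simp
    _ ≤ _ := ENNReal.ofReal_le_ofReal h2

end QuantumLDP

open QuantumLDP in
theorem corollary1
    (Θ : Set ℝ) (hΘ : IsOpen Θ)
    (ρ : ℝ → Qubit) (hρ : ContDiffOn ℝ 1 (fun t => (ρ t).toMatrix) Θ)
    (θ : ℝ) (hθ : θ ∈ Θ)
    (ω ω' : EuclideanSpace ℝ (Fin 3))
    (hω : ω = blochVector (ρ θ)) (hω' : ω' = deriv (fun t => blochVector (ρ t)) θ)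
    (hne : inner ℝ ω' ω ≠ 0)
    (α : ℝ) (hα : 0 < α) (ε : ℝ) (hε : ε ∈ Set.Ioo (0 : ℝ) 1) :
    ENNReal.ofReal (C₁ ω ω' / (9 * α * ε ^ 2)) ≤ (bestSampleComplexity ρ θ α ε : ℝ≥0∞) ∧
      (bestSampleComplexity ρ θ α ε : ℝ≥0∞) ≤
        ENNReal.ofReal (max 1 (C₂ ω' * (Real.exp 1 + 1) ^ 2 / (α * ε ^ 2))) := by
  have hder := hasDerivAt_blochVector hΘ hρ hθ
  rw [← hω'] at hder
  have hne' : ω' ≠ 0 := by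
    rintro rfl
    simp at hne
  exact ⟨le_bestSampleComplexity hder hne' ω hα hε, bestSampleComplexity_le hder hne' hα hε⟩
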